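/- Let $K$ be a field, let $\mathbb S_1=K\langle x,y\mid yx=1\rangle$, and let $E_{ij}=x^iy^j-x^{i+1}y^{j+1}\in\mathbb S_1$ for $i,j\in\mathbb N=\{0,1,\dots\}$, so that $E_{ij}E_{kl}=\delta_{jk}E_{il}$. Let $F=\bigoplus_{i,j}KE_{ij}$ and $\mathbb S_2=\mathbb S_1\otimes_K\mathbb S_1$, write $E_{ij}(1)=E_{ij}\otimes 1$ and $E_{ij}(2)=1\otimes E_{ij}$, and let $\mathfrak p_1=F\otimes\mathbb S_1$ and $$F_2=F\otimes F=\bigoplus_{\alpha,\beta\in\mathbb N^2}KE_{\alpha\beta}\subseteq\mathfrak p_1,\qquad E_{\alpha\beta}=E_{\alpha_1\beta_1}(1)E_{\alpha_2\beta_2}(2).$$ For an ideal $I$ let $(1+I)^*$ denote the group of units of the multiplicative monoid $1+I$. For a ring $R$ let $M_\infty(R)=\bigcup_d M_d(R)$, let $\mathrm{GL}_\infty(R)$ be the group of units of the monoid $1+M_\infty(R)$, and let $E_\infty(R)$ be its subgroup generated by all elementary matrices $1+rE_{ij}$ with $i\ne j$ and $r\in R$ (here $E_{ij}$ are the usual matrix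 units). Identify $\mathrm{GL}_\infty(\mathbb S_1)$ with $(1+\mathfrak p_1)^*$ by means of the group isomorphism $$1+\sum a_{ij}E_{ij}\;\mapsto\;1+\sum E_{ij}\otimes a_{ij};$$ thus $(1+F_2)^*$ is a subgroup of $\mathrm{GL}_\infty(\mathbb S_1)$. Let $\det:(1+F_2)^*\to K^*$ be the determinant: for $u=1+\sum_{\alpha,\beta\in S}c_{\alpha\beta}E_{\alpha\beta}$ with $S\subset\mathbb N^2$ finite, $\det(u)$ is the determinant of the finite matrix $(\delta_{\alpha\beta}+c_{\alpha\beta})_{\alpha,\beta\in S}$. Put $$\mathrm{SL}=\{u\in(1+F_2)^*\mid\det(u)=1\},\qquad U'=\{\mu'(\lambda)\mid\lambda\in K^*\},$$ where $\mu'(\lambda)=\lambda E_{00}(1)E_{00}(2)+1-E_{00}(1)E_{00}(2)\in(1+F_2)^*$. Then $\mathrm{SL}$ is a normal subgroup of $\mathrm{GL}_\infty(\mathbb S_1)$, both $\mathrm{SL}$ and $U'$ are contained in $E_\infty(\mathbb S_1)$, the homomorphism $K^*\to\mathrm{GL}_\infty(\mathbb S_1)/\mathrm{SL}$, $\lambda\mapsto\mu'(\lambda)\,\mathrm{SL}$,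 is injective (so that $U'\simeq K^*$ embeds in both quotient groups below), and the image of $U'$ is the centre of $\mathrm{GL}_\infty(\mathbb S_1)/\mathrm{SL}$ as well as the centre of $E_\infty(\mathbb S_1)/\mathrm{SL}$. -/

import Mathlib

open scoped TensorProduct

/-! ### The monoid `1 + I` and its group of units -/

/-- For an additive and multiplicative subgroup `I` (a ring without `1`) of a ring `A`, the
multiplicative monoid `1 + I`. The group `(1 + I)^*` is `(onePlus I)ˣ`. -/
def onePlus {A : Type*} [Ring A] (I : NonUnitalSubring A) : Submonoid A where
  carrier := {a | a - 1 ∈ I}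
  one_mem' := by simp [I.zero_mem]
  mul_mem' := by
    intro a b ha hb
    have h : a * b - 1 = (a - 1) * (b - 1) + (a - 1) + (b - 1) := by noncomm_ring
    simp only [Set.mem_ofPred_eq] at ha hb ⊢
    rw [h]
    exact I.add_mem (I.add_mem (I.mul_mem ha hb) ha) hb

/-! ### Infinite matrices: `M_∞(R)`, `GL_∞(R)` and `E_∞(R)` -/

section InfiniteMatrices

variable (R : Type*) [Ring R]

/-- Column-finite `ℕ × ℕ` matrices over `R`, i.e. the endomorphisms of the free right
`R`-module with basis `e_0, e_1, …` (columns, on which matrices act from the left). -/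
def ColMat : Type _ := Module.End Rᵐᵒᵖ (ℕ →₀ R)

noncomputable instance : Ring (ColMat R) := inferInstanceAs (Ring (Module.End Rᵐᵒᵖ (ℕ →₀ R)))

variable {R}

/-- A column-finite matrix as a right-linear map on columns. -/
def ColMat.lin (f : ColMat R) : Module.End Rᵐᵒᵖ (ℕ →₀ R) := f

/-- The `(i, j)` entry of a matrix: the `i`-th coordinate of the image of `e_j`. -/
noncomputable def ColMat.entry (f : ColMat R) (i j : ℕ) : R := f.lin (Finsupp.single j 1) i

/-- The matrix `r E_ij` as a linear map: `v ↦ e_i (r v_j)`. -/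
noncomputable def ColMat.unitLin (i j : ℕ) (r : R) : Module.End Rᵐᵒᵖ (ℕ →₀ R) where
  toFun v := Finsupp.single i (r * v j)
  map_add' v w := by simp [mul_add]
  map_smul' c v := by
    rw [Finsupp.smul_single]
    simp [mul_assoc]

/-- The matrix `r E_ij`: the entry `r` at place `(i, j)`, zeros elsewhere. -/
noncomputable def ColMat.unit (i j : ℕ) (r : R) : ColMat R := ColMat.unitLin i j r

theorem ColMat.entry_unit (i j k l : ℕ) (r : R) :
    (ColMat.unit i j r).entry k l = if i = k ∧ j = l then r else 0 := by
  change Finsupp.single i (r * Finsupp.single l (1 : R) j) k = _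
  rw [Finsupp.single_apply, Finsupp.single_apply]
  by_cases h1 : i = k <;> by_cases h2 : j = l <;>
    simp [h1, h2, eq_comm (a := l)]

theorem ColMat.entry_zero (i j : ℕ) : (0 : ColMat R).entry i j = 0 := rfl

theorem ColMat.entry_one (i j : ℕ) : (1 : ColMat R).entry i j = if j = i then 1 else 0 :=
  Finsupp.single_apply

theorem ColMat.entry_add (f g : ColMat R) (i j : ℕ) :
    (f + g).entry i j = f.entry i j + g.entry i j := rfl

theorem ColMat.entry_neg (f : ColMat R) (i j : ℕ) : (-f).entry i j = -f.entry i j := rfl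

theorem ColMat.lin_apply (f : ColMat R) (v : ℕ →₀ R) :
    f.lin v = v.sum fun j r => MulOpposite.op r • f.lin (Finsupp.single j 1) := by
  conv_lhs => rw [← Finsupp.sum_single v]
  rw [Finsupp.sum, map_sum]
  refine Finset.sum_congr rfl fun j _ => ?_
  change f.lin (Finsupp.single j (v j)) = MulOpposite.op (v j) • f.lin (Finsupp.single j 1)
  rw [← map_smul, Finsupp.smul_single]
  simp

theorem ColMat.ext_entry {f g : ColMat R} (h : ∀ i j, f.entry i j = g.entry i j) : f = g := by
  have hj : ∀ j, f.lin (Finsupp.single j 1) = g.lin (Finsupp.single j 1) := fun j =>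
    Finsupp.ext fun i => h i j
  have hl : f.lin = g.lin := LinearMap.ext fun v => by
    rw [ColMat.lin_apply f, ColMat.lin_apply g]
    simp [hj]
  exact hl

/-- `f` belongs to `M_d(R)`: all nonzero entries `f_ij` have `i, j < d`. -/
def ColMat.SuppLT (d : ℕ) (f : ColMat R) : Prop :=
  ∀ i j, d ≤ i ∨ d ≤ j → f.entry i j = 0

theorem ColMat.SuppLT.mono {d e : ℕ} (h : d ≤ e) {f : ColMat R} (hf : f.SuppLT d) :
    f.SuppLT e := fun i j hij => hf i j (hij.imp h.trans h.trans)

theorem ColMat.entry_mul (f g : ColMat R) {d : ℕ} (hg : g.SuppLT d) (i j : ℕ) :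
    (f * g).entry i j = ∑ k ∈ Finset.range d, f.entry i k * g.entry k j := by
  change f.lin (g.lin (Finsupp.single j 1)) i = _
  rw [ColMat.lin_apply f, Finsupp.sum_of_support_subset (s := Finset.range d)]
  · simp [Finsupp.finsetSum_apply, ColMat.entry]
  · intro k hk
    rw [Finset.mem_range]
    by_contra hkd
    exact (Finsupp.mem_support_iff.1 hk) (hg k j (Or.inl (not_lt.1 hkd)))
  · simp

variable (R)

/-- The ring without `1` of infinite matrices `M_∞(R) = ⋃_d M_d(R)`. -/
noncomputable def MInf : NonUnitalSubring (ColMat R) where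
  carrier := {f | ∃ d, f.SuppLT d}
  zero_mem' := ⟨0, fun _ _ _ => rfl⟩
  add_mem' := by
    rintro f g ⟨d, hd⟩ ⟨e, he⟩
    refine ⟨max d e, fun i j h => ?_⟩
    rw [ColMat.entry_add, hd.mono (le_max_left d e) i j h, he.mono (le_max_right d e) i j h,
      add_zero]
  neg_mem' := by
    rintro f ⟨d, hd⟩
    refine ⟨d, fun i j h => ?_⟩
    rw [ColMat.entry_neg, hd i j h, neg_zero]
  mul_mem' := by
    rintro f g ⟨d, hd⟩ ⟨e, he⟩
    refine ⟨max d e, fun i j h => ?_⟩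
    rw [ColMat.entry_mul f g he]
    refine Finset.sum_eq_zero fun k _ => ?_
    rcases h with h | h
    · rw [hd i k (Or.inl ((le_max_left d e).trans h)), zero_mul]
    · rw [he k j (Or.inr ((le_max_right d e).trans h)), mul_zero]

/-- `GL_∞(R)`: the group of units of the monoid `1 + M_∞(R)`. -/
abbrev GLInf : Type _ := (onePlus (MInf R))ˣ

/-- `E_∞(R)`: the subgroup of `GL_∞(R)` generated by the elementary matrices
`1 + r E_ij`, `i ≠ j`, `r ∈ R`. -/
noncomputable def EInf : Subgroup (GLInf R) :=
  Subgroup.closure {u | ∃ (i j : ℕ) (r : R), i ≠ j ∧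
    ((u : onePlus (MInf R)) : ColMat R) = 1 + ColMat.unit i j r}

end InfiniteMatrices

/-! ### The algebras `𝕊₁` and `𝕊₂ = 𝕊₁ ⊗ 𝕊₁` -/

section Algebras

variable (K : Type*) [Field K]

/-- The two generators of `𝕊₁`. -/
inductive S1Gen : Type
  | x : S1Gen
  | y : S1Gen

/-- The defining relation `y x = 1` of `𝕊₁`. -/
inductive S1Rel : FreeAlgebra K S1Gen → FreeAlgebra K S1Gen → Prop
  | yx : S1Rel (FreeAlgebra.ι K S1Gen.y * FreeAlgebra.ι K S1Gen.x) 1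

/-- The algebra `𝕊₁ = K⟨x, y | y x = 1⟩`. -/
def S1 : Type _ := RingQuot (S1Rel K)

noncomputable instance : Ring (S1 K) := inferInstanceAs (Ring (RingQuot (S1Rel K)))

noncomputable instance : Algebra K (S1 K) := inferInstanceAs (Algebra K (RingQuot (S1Rel K)))

namespace S1

/-- The generator `x`. -/
noncomputable def x : S1 K := RingQuot.mkAlgHom K (S1Rel K) (FreeAlgebra.ι K S1Gen.x)

/-- The generator `y`. -/
noncomputable def y : S1 K := RingQuot.mkAlgHom K (S1Rel K) (FreeAlgebra.ι K S1Gen.y)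

theorem y_mul_x : y K * x K = 1 := by
  have h := RingQuot.mkAlgHom_rel K (S1Rel.yx (K := K))
  rw [map_mul, map_one] at h
  exact h

/-- The matrix units `E_ij = x^i y^j - x^(i+1) y^(j+1)` of `𝕊₁`. -/
noncomputable def E (i j : ℕ) : S1 K := x K ^ i * y K ^ j - x K ^ (i + 1) * y K ^ (j + 1)

theorem E_eq (i j : ℕ) : E K i j = x K ^ i * E K 0 0 * y K ^ j := by
  simp only [E, pow_zero, zero_add, pow_one, mul_sub, sub_mul, mul_one, pow_succ (x K) i,
    pow_succ' (y K) j, mul_assoc]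

theorem E_mul_x : E K 0 0 * x K = 0 := by
  simp [E, sub_mul, mul_assoc, y_mul_x]

theorem y_mul_E : y K * E K 0 0 = 0 := by
  simp [E, mul_sub, ← mul_assoc, y_mul_x]

theorem y_pow_mul_x_pow (n : ℕ) : y K ^ n * x K ^ n = 1 := by
  induction n with
  | zero => simp
  | succ n ih =>
    rw [pow_succ, pow_succ', mul_assoc, ← mul_assoc (y K) (x K), y_mul_x, one_mul, ih]

theorem E00_mul_E00 : E K 0 0 * E K 0 0 = E K 0 0 := by
  have h : E K 0 0 = 1 - x K * y K := by simp [E]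
  calc E K 0 0 * E K 0 0 = (1 - x K * y K) * E K 0 0 := by rw [← h]
    _ = E K 0 0 := by rw [sub_mul, one_mul, mul_assoc, y_mul_E, mul_zero, sub_zero]

theorem E_mul_E (i j k l : ℕ) : E K i j * E K k l = if j = k then E K i l else 0 := by
  rw [E_eq K i j, E_eq K k l]
  have h : x K ^ i * E K 0 0 * y K ^ j * (x K ^ k * E K 0 0 * y K ^ l) =
      x K ^ i * (E K 0 0 * (y K ^ j * x K ^ k) * E K 0 0) * y K ^ l := by
    simp only [mul_assoc]
  rw [h]
  rcases lt_trichotomy j k with hjk | hjk | hjk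
  · obtain ⟨m, rfl⟩ := Nat.exists_eq_add_of_lt hjk
    rw [if_neg (by omega), add_assoc, pow_add, ← mul_assoc (y K ^ j), y_pow_mul_x_pow, one_mul,
      pow_succ', ← mul_assoc (E K 0 0), E_mul_x]
    simp
  · subst hjk
    rw [if_pos rfl, y_pow_mul_x_pow, mul_one, E00_mul_E00, E_eq K i l]
  · obtain ⟨m, rfl⟩ := Nat.exists_eq_add_of_lt hjk
    rw [if_neg (by omega), add_assoc, add_comm k, pow_add, mul_assoc (y K ^ (m + 1)),
      y_pow_mul_x_pow, mul_one, pow_succ, mul_assoc (E K 0 0), mul_assoc (y K ^ m), y_mul_E]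
    simp

/-- The linear map `y` on `P₁ = K[X]`: `X^(i+1) ↦ X^i`, `1 ↦ 0`. -/
noncomputable def divXₗ : Module.End K (Polynomial K) where
  toFun p := p.divX
  map_add' _ _ := Polynomial.divX_add
  map_smul' c p := by
    ext n
    simp [Polynomial.coeff_divX]

/-- The action of `𝕊₁` on the polynomial algebra `P₁ = K[X]`: `x * X^i = X^(i+1)`,
`y * X^(i+1) = X^i`, `y * 1 = 0`. -/
noncomputable def act : S1 K →ₐ[K] Module.End K (Polynomial K) :=
  RingQuot.liftAlgHom K ⟨FreeAlgebra.lift K fun g => match g with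
    | S1Gen.x => LinearMap.mulLeft K (Polynomial.X : Polynomial K)
    | S1Gen.y => divXₗ K, by
      rintro _ _ ⟨⟩
      rw [map_mul, map_one, FreeAlgebra.lift_ι_apply, FreeAlgebra.lift_ι_apply]
      refine LinearMap.ext fun p => Polynomial.ext fun n => ?_
      simp [divXₗ, Polynomial.coeff_divX]⟩

theorem act_x : act K (x K) = LinearMap.mulLeft K (Polynomial.X : Polynomial K) := by
  unfold act x
  erw [RingQuot.liftAlgHom_mkAlgHom_apply]
  rw [FreeAlgebra.lift_ι_apply]

theorem act_y : act K (y K) = divXₗ K := by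
  unfold act y
  erw [RingQuot.liftAlgHom_mkAlgHom_apply]
  rw [FreeAlgebra.lift_ι_apply]

/-- The `(i, j)` matrix coefficient of `a ∈ 𝕊₁`: the coefficient of `X^i` in `a * X^j`. -/
noncomputable def coef (i j : ℕ) : S1 K →ₗ[K] K :=
  Polynomial.lcoeff K i ∘ₗ LinearMap.applyₗ (Polynomial.X ^ j) ∘ₗ (act K).toLinearMap


theorem act_x_pow (n : ℕ) (p : Polynomial K) : act K (x K ^ n) p = Polynomial.X ^ n * p := by
  induction n with
  | zero => simp
  | succ n ih => rw [pow_succ', map_mul, act_x, Module.End.mul_apply, ih, LinearMap.mulLeft_apply,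
      pow_succ', mul_assoc]

theorem coeff_act_y_pow (n i : ℕ) (p : Polynomial K) :
    (act K (y K ^ n) p).coeff i = p.coeff (i + n) := by
  induction n generalizing i with
  | zero => simp
  | succ n ih =>
    rw [pow_succ', map_mul, act_y, Module.End.mul_apply]
    change (Polynomial.divX _).coeff i = _
    rw [Polynomial.coeff_divX, ih]
    congr 1
    ring

theorem coef_one (i j : ℕ) : coef K i j 1 = if i = j then 1 else 0 := by
  simp [coef, Polynomial.coeff_X_pow]

theorem coef_E (i j k l : ℕ) : coef K i j (E K k l) = if k = i ∧ l = j then 1 else 0 := by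
  have h : coef K i j (E K k l) =
      (act K (x K ^ k) (act K (y K ^ l) (Polynomial.X ^ j))).coeff i -
      (act K (x K ^ (k + 1)) (act K (y K ^ (l + 1)) (Polynomial.X ^ j))).coeff i := by
    change (act K (E K k l) (Polynomial.X ^ j)).coeff i = _
    rw [E, map_sub, map_mul, map_mul]
    simp
  rw [h, act_x_pow, act_x_pow, Polynomial.coeff_X_pow_mul', Polynomial.coeff_X_pow_mul',
    coeff_act_y_pow, coeff_act_y_pow, Polynomial.coeff_X_pow, Polynomial.coeff_X_pow]
  split_ifs <;> first | omega | simp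

end S1

/-- The algebra `𝕊₂ = 𝕊₁(1) ⊗ 𝕊₁(2)`; here `x₁ = x ⊗ 1`, `y₁ = y ⊗ 1`, `x₂ = 1 ⊗ x`,
`y₂ = 1 ⊗ y`. -/
abbrev S2 : Type _ := S1 K ⊗[K] S1 K

namespace S2

/-- The linear span of a subset closed under multiplication, as a ring without `1`. -/
noncomputable def spanRing (s : Set (S2 K))
    (hs : ∀ a ∈ s, ∀ b ∈ s, a * b ∈ Submodule.span K s) : NonUnitalSubring (S2 K) where
  carrier := Submodule.span K s
  zero_mem' := Submodule.zero_mem _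
  add_mem' := Submodule.add_mem _
  neg_mem' := Submodule.neg_mem _
  mul_mem' := by
    intro a b ha hb
    have h := Submodule.mul_mem_mul ha hb
    rw [Submodule.span_mul_span] at h
    refine Submodule.span_le.2 ?_ h
    rintro _ ⟨u, hu, v, hv, rfl⟩
    exact hs u hu v hv

/-- The matrix units `E_αβ = E_{α₁β₁}(1) E_{α₂β₂}(2)` of `𝕊₂`, `α, β ∈ ℕ²`. -/
noncomputable def E (α β : ℕ × ℕ) : S2 K := S1.E K α.1 β.1 ⊗ₜ S1.E K α.2 β.2

theorem E_mul_E (α β γ δ : ℕ × ℕ) : E K α β * E K γ δ = if β = γ then E K α δ else 0 := by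
  rw [E, E, Algebra.TensorProduct.tmul_mul_tmul, S1.E_mul_E, S1.E_mul_E]
  by_cases h1 : β.1 = γ.1 <;> by_cases h2 : β.2 = γ.2 <;>
    simp [Prod.ext_iff, h1, h2, E]

/-- The height one prime `𝔭₁ = F(1) ⊗ 𝕊₁(2)`, where `F = ⨁ K E_ij`: the span of all
`a E_ij(1)`, `a ∈ 𝕊₁(2)`. -/
noncomputable def p1 : NonUnitalSubring (S2 K) :=
  spanRing K {w | ∃ (i j : ℕ) (a : S1 K), w = S1.E K i j ⊗ₜ a} (by
    rintro _ ⟨i, j, a, rfl⟩ _ ⟨k, l, b, rfl⟩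
    rw [Algebra.TensorProduct.tmul_mul_tmul, S1.E_mul_E]
    split_ifs
    · exact Submodule.subset_span ⟨i, l, a * b, rfl⟩
    · rw [TensorProduct.zero_tmul]
      exact Submodule.zero_mem _)

/-- The ideal `F₂ = F(1) ⊗ F(2) = ⨁ K E_αβ`. -/
noncomputable def F2 : NonUnitalSubring (S2 K) :=
  spanRing K {w | ∃ α β : ℕ × ℕ, w = E K α β} (by
    rintro _ ⟨α, β, rfl⟩ _ ⟨γ, δ, rfl⟩
    rw [E_mul_E]
    split_ifs
    · exact Submodule.subset_span ⟨α, δ, rfl⟩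
    · exact Submodule.zero_mem _)

theorem F2_le_p1 : F2 K ≤ p1 K := by
  intro w hw
  refine Submodule.span_mono (R := K) ?_ hw
  rintro _ ⟨α, β, rfl⟩
  exact ⟨_, _, _, rfl⟩

/-! #### The identification of `(1 + 𝔭₁)^*` with `GL_∞(𝕊₁)` -/

/-- The map `∑ a_ij E_ij ↦ ∑ a_ij E_ij(1)`, with `a_ij ∈ 𝕊₁ = 𝕊₁(2)`. -/
noncomputable def ofMat (f : ColMat (S1 K)) : S2 K :=
  ∑ᶠ q : ℕ × ℕ, S1.E K q.1 q.2 ⊗ₜ f.entry q.1 q.2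

theorem ofMat_eq (f : ColMat (S1 K)) {d : ℕ} (hf : f.SuppLT d) :
    ofMat K f = ∑ i ∈ Finset.range d, ∑ j ∈ Finset.range d, S1.E K i j ⊗ₜ f.entry i j := by
  rw [ofMat, ← Finset.sum_product', finsum_eq_sum_of_support_subset]
  intro q hq
  by_contra h
  refine hq ?_
  have : d ≤ q.1 ∨ d ≤ q.2 := by
    by_contra! hh
    exact h (by simp [hh.1, hh.2])
  simp only [hf q.1 q.2 this, TensorProduct.tmul_zero]

theorem ofMat_add {f g : ColMat (S1 K)} (hf : f ∈ MInf (S1 K)) (hg : g ∈ MInf (S1 K)) :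
    ofMat K (f + g) = ofMat K f + ofMat K g := by
  obtain ⟨d, hd⟩ := hf
  obtain ⟨e, he⟩ := hg
  have hd' := hd.mono (le_max_left d e)
  have he' := he.mono (le_max_right d e)
  have hs : (f + g).SuppLT (max d e) := fun i j h => by
    rw [ColMat.entry_add, hd' i j h, he' i j h, add_zero]
  rw [ofMat_eq K _ hs, ofMat_eq K _ hd', ofMat_eq K _ he']
  simp only [ColMat.entry_add, TensorProduct.tmul_add, Finset.sum_add_distrib]

theorem ofMat_mul {f g : ColMat (S1 K)} (hf : f ∈ MInf (S1 K)) (hg : g ∈ MInf (S1 K)) :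
    ofMat K (f * g) = ofMat K f * ofMat K g := by
  obtain ⟨d, hd⟩ := hf
  obtain ⟨e, he⟩ := hg
  have hd' := hd.mono (le_max_left d e)
  have he' := he.mono (le_max_right d e)
  have hs : (f * g).SuppLT (max d e) := fun i j h => by
    rw [ColMat.entry_mul f g he']
    refine Finset.sum_eq_zero fun k _ => ?_
    rcases h with h | h
    · rw [hd' i k (Or.inl h), zero_mul]
    · rw [he' k j (Or.inr h), mul_zero]
  rw [ofMat_eq K _ hs, ofMat_eq K _ hd', ofMat_eq K _ he', Finset.sum_mul]
  refine Finset.sum_congr rfl fun i _ => ?_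
  rw [Finset.sum_mul]
  simp only [Finset.mul_sum, Algebra.TensorProduct.tmul_mul_tmul, S1.E_mul_E,
    ColMat.entry_mul f g he', TensorProduct.tmul_sum]
  rw [Finset.sum_comm]
  refine Finset.sum_congr rfl fun k hk => ?_
  rw [Finset.sum_comm]
  refine Finset.sum_congr rfl fun j _ => ?_
  rw [Finset.sum_eq_single k]
  · simp
  · intro b _ hb
    simp [hb.symm]
  · intro h
    exact absurd hk h

theorem ofMat_unit (i j : ℕ) (a : S1 K) : ofMat K (ColMat.unit i j a) = S1.E K i j ⊗ₜ a := by
  rw [ofMat, finsum_eq_single _ (i, j)]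
  · simp [ColMat.entry_unit]
  · rintro ⟨k, l⟩ h
    rw [ColMat.entry_unit, if_neg, TensorProduct.tmul_zero]
    rintro ⟨rfl, rfl⟩
    exact h rfl

theorem unit_mem (i j : ℕ) (a : S1 K) : ColMat.unit i j a ∈ MInf (S1 K) := by
  refine ⟨max i j + 1, fun k l h => ?_⟩
  rw [ColMat.entry_unit, if_neg]
  rintro ⟨rfl, rfl⟩
  omega

theorem ofMat_mem {f : ColMat (S1 K)} (hf : f ∈ MInf (S1 K)) : ofMat K f ∈ p1 K := by
  obtain ⟨d, hd⟩ := hf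
  rw [ofMat_eq K _ hd]
  exact sum_mem fun i _ => sum_mem fun j _ => Submodule.subset_span ⟨i, j, _, rfl⟩

theorem exists_ofMat {w : S2 K} (hw : w ∈ p1 K) : ∃ f ∈ MInf (S1 K), ofMat K f = w := by
  have hw' : w ∈ Submodule.span K {w : S2 K | ∃ (i j : ℕ) (a : S1 K), w = S1.E K i j ⊗ₜ a} := hw
  refine Submodule.closure_induction ?_ ?_ ?_ hw'
  · exact ⟨0, (MInf (S1 K)).zero_mem, by rw [ofMat_eq K (d := 0) _ fun _ _ _ => rfl]; simp⟩
  · rintro u v _ _ ⟨f, hf, rfl⟩ ⟨g, hg, rfl⟩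
    exact ⟨f + g, (MInf (S1 K)).add_mem hf hg, ofMat_add K hf hg⟩
  · rintro c _ ⟨i, j, a, rfl⟩
    refine ⟨ColMat.unit i j (c • a), unit_mem K i j _, ?_⟩
    rw [ofMat_unit, TensorProduct.tmul_smul]

/-- The linear map `𝕊₂ → 𝕊₁(2)`, `b ⊗ a ↦ b_ij a`, where `b_ij` is a matrix coefficient. -/
noncomputable def slice (i j : ℕ) : S2 K →ₗ[K] S1 K :=
  (TensorProduct.lid K (S1 K)).toLinearMap ∘ₗ LinearMap.rTensor (S1 K) (S1.coef K i j)

theorem slice_ofMat {f : ColMat (S1 K)} (hf : f ∈ MInf (S1 K)) (i j : ℕ) :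
    slice K i j (ofMat K f) = f.entry i j := by
  obtain ⟨d, hd⟩ := hf
  have hd' := hd.mono (show d ≤ d + i + j + 1 by omega)
  rw [ofMat_eq K _ hd', map_sum, Finset.sum_eq_single i, map_sum, Finset.sum_eq_single j]
  · simp [slice, S1.coef_E]
  · intro l _ hl
    simp [slice, S1.coef_E, hl]
  · intro h
    exact absurd (Finset.mem_range.2 (by omega)) h
  · intro k _ hk
    simp [slice, S1.coef_E, hk]
  · intro h
    exact absurd (Finset.mem_range.2 (by omega)) h

/-- The map `1 + M_∞(𝕊₁) → 1 + 𝔭₁`, `1 + ∑ a_ij E_ij ↦ 1 + ∑ a_ij E_ij(1)`. -/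
noncomputable def ofOnePlus : onePlus (MInf (S1 K)) →* onePlus (p1 K) where
  toFun f := ⟨1 + ofMat K (f.1 - 1), by
    change 1 + ofMat K (f.1 - 1) - 1 ∈ p1 K
    rw [add_sub_cancel_left]
    exact ofMat_mem K f.2⟩
  map_one' := by
    refine Subtype.ext ?_
    change 1 + ofMat K (1 - 1) = 1
    rw [sub_self (1 : ColMat (S1 K)), ofMat_eq K (d := 0) _ fun _ _ _ => rfl]
    simp
  map_mul' := by
    rintro ⟨f, hf⟩ ⟨g, hg⟩
    refine Subtype.ext ?_
    change 1 + ofMat K (f * g - 1) = (1 + ofMat K (f - 1)) * (1 + ofMat K (g - 1))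
    have h : f * g - 1 = (f - 1) * (g - 1) + (f - 1) + (g - 1) := by noncomm_ring
    have hfg := (MInf (S1 K)).mul_mem hf hg
    rw [h, ofMat_add K ((MInf (S1 K)).add_mem hfg hf) hg, ofMat_add K hfg hf, ofMat_mul K hf hg]
    noncomm_ring

theorem ofOnePlus_bijective : Function.Bijective (ofOnePlus K) := by
  constructor
  · rintro ⟨f, hf⟩ ⟨g, hg⟩ h
    have h' : 1 + ofMat K (f - 1) = 1 + ofMat K (g - 1) := congrArg Subtype.val h
    have h2 := add_left_cancel h'
    refine Subtype.ext (sub_left_injective (b := 1) (ColMat.ext_entry fun i j => ?_))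
    change (f - 1).entry i j = (g - 1).entry i j
    rw [← slice_ofMat K hf, h2, slice_ofMat K hg]
  · rintro ⟨w, hw⟩
    obtain ⟨f, hf, h⟩ := exists_ofMat K hw
    refine ⟨⟨1 + f, ?_⟩, Subtype.ext ?_⟩
    · change 1 + f - 1 ∈ MInf (S1 K)
      rwa [add_sub_cancel_left]
    · change 1 + ofMat K (1 + f - 1) = w
      rw [add_sub_cancel_left, h, add_sub_cancel]

/-- The group isomorphism `GL_∞(𝕊₁) ≃ (1 + 𝔭₁)^*`,
`1 + ∑ a_ij E_ij ↦ 1 + ∑ a_ij E_ij(1)`. -/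
noncomputable def glEquiv : GLInf (S1 K) ≃* (onePlus (p1 K))ˣ :=
  Units.mapEquiv (MulEquiv.ofBijective (ofOnePlus K) (ofOnePlus_bijective K))

/-- The embedding of `(1 + F₂)^* ⊆ (1 + 𝔭₁)^*` in `GL_∞(𝕊₁)`. -/
noncomputable def toGL : (onePlus (F2 K))ˣ →* GLInf (S1 K) :=
  (glEquiv K).symm.toMonoidHom.comp
    (Units.map (Submonoid.inclusion fun _ h => F2_le_p1 K h))

/-! #### The determinant on `(1 + F₂)^*` -/

/-- The `(α, β)` matrix coefficient of `w ∈ 𝕊₂`: the coefficient of `x^α` in `w * x^β`, for the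
action of `𝕊₂ = 𝕊₁ ⊗ 𝕊₁` on `P₂ = K[x₁] ⊗ K[x₂]`. -/
noncomputable def coef (α β : ℕ × ℕ) : S2 K →ₗ[K] K :=
  LinearMap.mul' K K ∘ₗ TensorProduct.map (S1.coef K α.1 β.1) (S1.coef K α.2 β.2)

theorem coef_one (α β : ℕ × ℕ) : coef K α β 1 = if α = β then 1 else 0 := by
  rw [Algebra.TensorProduct.one_def]
  by_cases h1 : α.1 = β.1 <;> by_cases h2 : α.2 = β.2 <;>
    simp [coef, S1.coef_one, Prod.ext_iff, h1, h2]

theorem coef_E (α β γ δ : ℕ × ℕ) :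
    coef K α β (E K γ δ) = if γ = α ∧ δ = β then 1 else 0 := by
  by_cases h1 : γ.1 = α.1 <;> by_cases h2 : γ.2 = α.2 <;> by_cases h3 : δ.1 = β.1 <;>
    by_cases h4 : δ.2 = β.2 <;> simp [coef, E, S1.coef_E, Prod.ext_iff, h1, h2, h3, h4]

/-- The indices of the rows and columns in which the matrix of `w` is nonzero. -/
def idx (w : S2 K) : Set (ℕ × ℕ) := {α | ∃ β, coef K α β w ≠ 0 ∨ coef K β α w ≠ 0}

/-- The element of `F₂` with a given finite matrix. -/
noncomputable def ofBlock (s : Finset (ℕ × ℕ)) (A : Matrix s s K) : S2 K :=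
  ∑ a : s, ∑ b : s, A a b • E K a b

/-- The finite block with index set `s` of the matrix of `w`. -/
noncomputable def block (s : Finset (ℕ × ℕ)) (w : S2 K) : Matrix s s K :=
  Matrix.of fun a b => coef K a b w

theorem coef_ofBlock (s : Finset (ℕ × ℕ)) (A : Matrix s s K) (α β : ℕ × ℕ) :
    coef K α β (ofBlock K s A) =
      if h : α ∈ s ∧ β ∈ s then A ⟨α, h.1⟩ ⟨β, h.2⟩ else 0 := by
  simp only [ofBlock, map_sum, map_smul, coef_E, smul_eq_mul, mul_ite, mul_one, mul_zero]
  split_ifs with h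
  · rw [Finset.sum_eq_single ⟨α, h.1⟩, Finset.sum_eq_single ⟨β, h.2⟩]
    · simp
    · intro b _ hb
      exact if_neg fun hh => hb (Subtype.ext hh.2)
    · simp
    · intro a _ ha
      exact Finset.sum_eq_zero fun b _ => if_neg fun hh => ha (Subtype.ext hh.1)
    · simp
  · refine Finset.sum_eq_zero fun a _ => Finset.sum_eq_zero fun b _ => if_neg fun hh => h ?_
    rw [← hh.1, ← hh.2]
    exact ⟨a.2, b.2⟩

theorem block_ofBlock (s : Finset (ℕ × ℕ)) (A : Matrix s s K) :
    block K s (ofBlock K s A) = A := by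
  ext a b
  simp [block, coef_ofBlock]

theorem ofBlock_mul (s : Finset (ℕ × ℕ)) (A B : Matrix s s K) :
    ofBlock K s (A * B) = ofBlock K s A * ofBlock K s B := by
  simp only [ofBlock, Finset.sum_mul, Matrix.mul_apply, Finset.sum_smul]
  refine Finset.sum_congr rfl fun a _ => ?_
  rw [Finset.sum_comm]
  refine Finset.sum_congr rfl fun c _ => ?_
  simp only [Finset.mul_sum, smul_mul_smul_comm, E_mul_E]
  symm
  rw [Finset.sum_eq_single c]
  · simp
  · intro b _ hb
    refine Finset.sum_eq_zero fun d _ => ?_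
    rw [if_neg fun h => hb (Subtype.ext h).symm, smul_zero]
  · simp

theorem exists_ofBlock {w : S2 K} (hw : w ∈ F2 K) :
    ∃ s : Finset (ℕ × ℕ), ∀ t, s ⊆ t → w = ofBlock K t (block K t w) := by
  have hw' : w ∈ Submodule.span K {w : S2 K | ∃ α β : ℕ × ℕ, w = E K α β} := hw
  induction hw' using Submodule.span_induction with
  | mem w h =>
    obtain ⟨α, β, rfl⟩ := h
    refine ⟨{α, β}, fun t ht => ?_⟩
    have hα : α ∈ t := ht (by simp)
    have hβ : β ∈ t := ht (by simp)
    simp only [ofBlock, block, Matrix.of_apply, coef_E]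
    rw [Finset.sum_eq_single ⟨α, hα⟩, Finset.sum_eq_single ⟨β, hβ⟩]
    · simp
    · intro b _ hb
      rw [if_neg fun hh => hb (Subtype.ext hh.2.symm), zero_smul]
    · simp
    · intro a _ ha
      refine Finset.sum_eq_zero fun b _ => ?_
      rw [if_neg fun hh => ha (Subtype.ext hh.1.symm), zero_smul]
    · simp
  | zero => exact ⟨∅, fun t _ => by simp [ofBlock, block]⟩
  | add u v hu hv ihu ihv =>
    obtain ⟨s, hs⟩ := ihu hu
    obtain ⟨s', hs'⟩ := ihv hv
    refine ⟨s ∪ s', fun t ht => ?_⟩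
    conv_lhs => rw [hs t (Finset.union_subset_left ht), hs' t (Finset.union_subset_right ht)]
    simp only [ofBlock, block, Matrix.of_apply, map_add, add_smul, Finset.sum_add_distrib]
  | smul c u hu ihu =>
    obtain ⟨s, hs⟩ := ihu hu
    refine ⟨s, fun t ht => ?_⟩
    conv_lhs => rw [hs t ht]
    simp only [ofBlock, block, Matrix.of_apply, map_smul, smul_assoc, Finset.smul_sum]

theorem idx_finite {w : S2 K} (hw : w ∈ F2 K) : (idx K w).Finite := by
  obtain ⟨s, hs⟩ := exists_ofBlock K hw
  refine s.finite_toSet.subset ?_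
  rintro α ⟨β, h⟩
  rw [hs s subset_rfl, coef_ofBlock, coef_ofBlock] at h
  by_contra hα
  rw [Finset.mem_coe] at hα
  simp [hα] at h

/-- The determinant of `u ∈ 1 + F₂ ≃ 1 + M_∞(K)`: the determinant of the finite block of the
matrix of `u` outside of which `u` agrees with the identity matrix. -/
noncomputable def detFun (u : onePlus (F2 K)) : K :=
  (block K (idx_finite K u.2).toFinset (u : S2 K)).det

theorem detFun_eq (u : onePlus (F2 K)) (s : Finset (ℕ × ℕ))
    (hs : (idx_finite K u.2).toFinset ⊆ s) : detFun K u = (block K s (u : S2 K)).det := by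
  classical
  have key : ∀ α β : ℕ × ℕ, (α ∉ (idx_finite K u.2).toFinset ∨
      β ∉ (idx_finite K u.2).toFinset) → coef K α β (u : S2 K) = if α = β then 1 else 0 := by
    intro α β h
    rw [← coef_one, ← sub_eq_zero, ← map_sub]
    by_contra hne
    rcases h with h | h
    · exact h ((Set.Finite.mem_toFinset _).2 ⟨β, Or.inl hne⟩)
    · exact h ((Set.Finite.mem_toFinset _).2 ⟨α, Or.inr hne⟩)
  rw [Matrix.twoBlockTriangular_det (block K s (u : S2 K))
    (fun a => (a : ℕ × ℕ) ∈ (idx_finite K u.2).toFinset)]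
  · have h2 : Matrix.toSquareBlockProp (block K s (u : S2 K))
        (fun a => ¬ (a : ℕ × ℕ) ∈ (idx_finite K u.2).toFinset) = 1 := by
      ext a b
      change coef K _ _ _ = _
      rw [key _ _ (Or.inl a.2), Matrix.one_apply]
      simp only [Subtype.ext_iff]
    rw [h2, Matrix.det_one, mul_one, detFun]
    let e : {a : s // (a : ℕ × ℕ) ∈ (idx_finite K u.2).toFinset} ≃
        (idx_finite K u.2).toFinset :=
      ⟨fun a => ⟨a.1, a.2⟩, fun a => ⟨⟨a.1, hs a.2⟩, a.2⟩, fun _ => rfl, fun _ => rfl⟩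
    rw [← Matrix.det_submatrix_equiv_self e]
    rfl
  · intro a ha b hb
    change coef K _ _ _ = _
    rw [key _ _ (Or.inl ha), if_neg]
    intro h
    exact ha (h ▸ hb)

/-- The determinant as a homomorphism of monoids `1 + F₂ → K`. -/
noncomputable def detMon : onePlus (F2 K) →* K where
  toFun := detFun K
  map_one' := by
    have h : block K (idx_finite K (1 : onePlus (F2 K)).2).toFinset (1 : S2 K) = 1 := by
      ext a b
      simp only [block, Matrix.of_apply, coef_one, Matrix.one_apply, Subtype.ext_iff]
    change Matrix.det _ = _
    exact (congrArg Matrix.det h).trans Matrix.det_one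
  map_mul' u v := by
    classical
    obtain ⟨s, hs⟩ := exists_ofBlock K u.2
    obtain ⟨s', hs'⟩ := exists_ofBlock K v.2
    let t := s ∪ s' ∪ ((idx_finite K u.2).toFinset ∪ (idx_finite K v.2).toFinset ∪
      (idx_finite K (u * v).2).toFinset)
    have hu := hs t (by intro a ha; simp only [t, Finset.mem_union]; tauto)
    have hv := hs' t (by intro a ha; simp only [t, Finset.mem_union]; tauto)
    rw [detFun_eq K u t (by intro a ha; simp only [t, Finset.mem_union]; tauto),
      detFun_eq K v t (by intro a ha; simp only [t, Finset.mem_union]; tauto),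
      detFun_eq K (u * v) t (by intro a ha; simp only [t, Finset.mem_union]; tauto),
      ← Matrix.det_mul]
    congr 1
    have hone : block K t (1 : S2 K) = 1 := by
      ext a b
      simp only [block, Matrix.of_apply, coef_one, Matrix.one_apply, Subtype.ext_iff]
    have hadd : ∀ w z : S2 K, block K t (w + z) = block K t w + block K t z := fun w z => by
      ext a b
      simp [block]
    set f : S2 K := (u : S2 K) - 1 with hf
    set g : S2 K := (v : S2 K) - 1 with hg
    have hu1 : (u : S2 K) = 1 + f := by rw [hf]; abel
    have hv1 : (v : S2 K) = 1 + g := by rw [hg]; abel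
    have hmul : block K t (f * g) = block K t f * block K t g := by
      conv_lhs => rw [hu, hv, ← ofBlock_mul, block_ofBlock]
    have huv : ((u * v : onePlus (F2 K)) : S2 K) = 1 + f + (g + f * g) := by
      rw [Submonoid.coe_mul, hu1, hv1]
      noncomm_ring
    rw [huv, hu1, hv1, hadd, hadd, hadd, hadd, hone, hmul]
    noncomm_ring

/-- The determinant `det : (1 + F₂)^* → K^*`. -/
noncomputable def det : (onePlus (F2 K))ˣ →* Kˣ := Units.map (detMon K)

/-- The homomorphism `μ' : K^* → (1 + F₂)^*`,
`μ'(c) = c E_00(1) E_00(2) + 1 - E_00(1) E_00(2)`. -/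
noncomputable def mu' : Kˣ →* (onePlus (F2 K))ˣ :=
  Units.map
    { toFun := fun c => ⟨c • E K (0, 0) (0, 0) + 1 - E K (0, 0) (0, 0), by
        change c • E K (0, 0) (0, 0) + 1 - E K (0, 0) (0, 0) - 1 ∈ F2 K
        have h : c • E K (0, 0) (0, 0) + 1 - E K (0, 0) (0, 0) - 1 =
            (c - 1) • E K (0, 0) (0, 0) := by
          rw [sub_smul, one_smul]
          abel
        rw [h]
        exact Submodule.smul_mem _ _ (Submodule.subset_span ⟨_, _, rfl⟩)⟩
      map_one' := Subtype.ext (by simp)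
      map_mul' := fun c d => Subtype.ext (by
        simp only [Submonoid.mk_mul_mk]
        have h : E K (0, 0) (0, 0) * E K (0, 0) (0, 0) = E K (0, 0) (0, 0) := by
          rw [E_mul_E, if_pos rfl]
        simp only [add_mul, mul_add, sub_mul, mul_sub, smul_mul_assoc, mul_smul_comm, h, mul_one,
          one_mul]
        module) }

end S2

/-- `SL`, the kernel of `det : (1 + F₂)^* → K^*`, as a subgroup of
`GL_∞(𝕊₁) = (1 + 𝔭₁)^* ⊇ (1 + F₂)^*`. -/
noncomputable def SLsub : Subgroup (GLInf (S1 K)) := (S2.det K).ker.map (S2.toGL K)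

/-- `U' = {μ'(c) | c ∈ K^*}`, as a subgroup of `GL_∞(𝕊₁)`. -/
noncomputable def U' : Subgroup (GLInf (S1 K)) := (S2.mu' K).range.map (S2.toGL K)

end Algebras

/-! All computations take place in `S2 K`, into which `toS2` embeds `GL_∞(𝕊₁)` and in which `F₂` is
a two-sided ideal.

Why `(1 + F₂)^*` is elementary. Whitehead's factorization of `diag(a, a⁻¹)` still makes sense when
only `b a = 1`: it yields a triangular block with diagonal `a, b` and corner `-(1 - a b)`. The
commutator of this block with an elementary scalar diagonal matrix is the diagonal matrix acting as
`c` on the idempotent `1 - a b` (`exists_mem_EInf_diag`). For `a = x^n`, `b = y^n` this idempotent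
is the sum of the `E_mm` with `m < n`, so comparing `n` with `n + 1` isolates `1 + (c - 1) E_αα`, an
elementary matrix of arbitrary determinant `c`. Together with the transvections `1 + c E_αβ`,
Gaussian elimination then gives all of `(1 + F₂)^*` (`toGL_mem_EInf`).

Why the image of `U'` is central. The identity `det(1 + AB) = det(1 + BA)` makes `det` invariant
under conjugation by `GL_∞(𝕊₁)` (`exists_conj_toGL`). Hence `SL` is normal and `(1 + F₂)^*/SL` is
central. Since `μ'` is a section of `det`, that quotient is the injective image of `K^*`.

Why nothing else is central. If `g` commutes modulo `SL` with `E_∞(𝕊₁)`, then it commutes with it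
modulo `F₂`. Testing against `1 + E_id(1)`, with `d` beyond the support of `g - 1`, forces `g - 1 ∈
F₂` (`exists_mu'_of_commute`). Only elementary matrices serve as tests, so both centres are covered
at once. -/

namespace S1

variable {K : Type*} [Field K]

/-! ### Matrix units and the ideal `F` of `𝕊₁`. -/

theorem x_mul_E (i j : ℕ) : x K * E K i j = E K (i + 1) j := by
  rw [E_eq, E_eq K (i + 1), pow_succ']
  simp only [mul_assoc]

theorem E_mul_y (i j : ℕ) : E K i j * y K = E K i (j + 1) := by
  rw [E_eq, E_eq K i (j + 1), pow_succ]
  simp only [mul_assoc]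

theorem y_mul_E_succ (i j : ℕ) : y K * E K (i + 1) j = E K i j := by
  rw [← x_mul_E, ← mul_assoc, y_mul_x, one_mul]

theorem E_succ_mul_x (i j : ℕ) : E K i (j + 1) * x K = E K i j := by
  rw [← E_mul_y, mul_assoc, y_mul_x, mul_one]

theorem y_mul_E_zero (j : ℕ) : y K * E K 0 j = 0 := by
  rw [E_eq, pow_zero, one_mul, ← mul_assoc, y_mul_E, zero_mul]

theorem E_zero_mul_x (i : ℕ) : E K i 0 * x K = 0 := by
  rw [E_eq, pow_zero, mul_one, mul_assoc, E_mul_x, mul_zero]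

/-- An induction principle for `𝕊₁`. -/
theorem induction {p : S1 K → Prop} (halg : ∀ c : K, p (algebraMap K (S1 K) c)) (hx : p (x K))
    (hy : p (y K)) (hmul : ∀ a b, p a → p b → p (a * b)) (hadd : ∀ a b, p a → p b → p (a + b))
    (a : S1 K) : p a := by
  obtain ⟨b, rfl⟩ := RingQuot.mkAlgHom_surjective K (S1Rel K) a
  induction b using FreeAlgebra.induction with
  | grade0 c =>
    rw [AlgHom.commutes]
    exact halg c
  | grade1 g =>
    cases g
    · exact hx
    · exact hy
  | mul a b ha hb =>
    rw [map_mul]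
    exact hmul _ _ ha hb
  | add a b ha hb =>
    rw [map_add]
    exact hadd _ _ ha hb

variable (K) in
/-- The ideal `F = ⨁ K E_ij` of `𝕊₁`, as a subspace. -/
noncomputable def F : Submodule K (S1 K) := Submodule.span K {w | ∃ i j : ℕ, w = E K i j}

theorem E_mem_F (i j : ℕ) : E K i j ∈ F K := Submodule.subset_span ⟨i, j, rfl⟩

/-- It suffices to treat the generators: `x` and `y` shift the row index of a matrix unit, and `y`
kills row `0`. -/
theorem mul_mem_F_left (a : S1 K) : ∀ f ∈ F K, a * f ∈ F K := by
  have key : ∀ a : S1 K, (∀ i j, a * E K i j ∈ F K) → ∀ f ∈ F K, a * f ∈ F K := by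
    intro a h f hf
    refine (Submodule.span_le (p := (F K).comap (LinearMap.mulLeft K a))).2 ?_ hf
    rintro _ ⟨i, j, rfl⟩
    exact h i j
  induction a using S1.induction with
  | halg c =>
    intro f hf
    rw [← Algebra.smul_def]
    exact Submodule.smul_mem _ _ hf
  | hx =>
    refine key _ fun i j => ?_
    rw [x_mul_E]
    exact E_mem_F _ _
  | hy =>
    refine key _ fun i j => ?_
    cases i with
    | zero => rw [y_mul_E_zero]; exact Submodule.zero_mem _
    | succ i => rw [y_mul_E_succ]; exact E_mem_F _ _
  | hmul a b ha hb =>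
    intro f hf
    rw [mul_assoc]
    exact ha _ (hb _ hf)
  | hadd a b ha hb =>
    intro f hf
    rw [add_mul]
    exact Submodule.add_mem _ (ha _ hf) (hb _ hf)

theorem mul_mem_F_right (a : S1 K) : ∀ f ∈ F K, f * a ∈ F K := by
  have key : ∀ a : S1 K, (∀ i j, E K i j * a ∈ F K) → ∀ f ∈ F K, f * a ∈ F K := by
    intro a h f hf
    refine (Submodule.span_le (p := (F K).comap (LinearMap.mulRight K a))).2 ?_ hf
    rintro _ ⟨i, j, rfl⟩
    exact h i j
  induction a using S1.induction with
  | halg c =>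
    intro f hf
    rw [← Algebra.commutes, ← Algebra.smul_def]
    exact Submodule.smul_mem _ _ hf
  | hx =>
    refine key _ fun i j => ?_
    cases j with
    | zero => rw [E_zero_mul_x]; exact Submodule.zero_mem _
    | succ j => rw [E_succ_mul_x]; exact E_mem_F _ _
  | hy =>
    refine key _ fun i j => ?_
    rw [E_mul_y]
    exact E_mem_F _ _
  | hmul a b ha hb =>
    intro f hf
    rw [← mul_assoc]
    exact hb _ (ha _ hf)
  | hadd a b ha hb =>
    intro f hf
    rw [mul_add]
    exact Submodule.add_mem _ (ha _ hf) (hb _ hf)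

/-- The sum defining `1 - x^n y^n = E_00 + ⋯ + E_(n-1)(n-1)` telescopes. With the orthogonality in
the next lemma, this lets a single `E_nn` be split off multiplicatively. -/
theorem one_sub_x_pow_mul_y_pow_succ (n : ℕ) :
    1 - x K ^ (n + 1) * y K ^ (n + 1) = (1 - x K ^ n * y K ^ n) + E K n n := by
  rw [E]
  abel

theorem one_sub_x_pow_mul_y_pow_mul_E (n : ℕ) : (1 - x K ^ n * y K ^ n) * E K n n = 0 := by
  have h : y K ^ n * E K n n = E K 0 n := by
    rw [E_eq K n, E_eq K 0 n, pow_zero, mul_assoc (x K ^ n), ← mul_assoc (y K ^ n), y_pow_mul_x_pow,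
      mul_assoc]
  have h' : x K ^ n * E K 0 n = E K n n := by
    rw [E_eq K n, E_eq K 0 n, pow_zero, one_mul, mul_assoc]
  rw [sub_mul, one_mul, mul_assoc, h, h', sub_self]

end S1

/-! ### `F₂` as a two-sided ideal of `𝕊₂`. -/

namespace S2

variable {K : Type*} [Field K]

theorem tmul_mem_F2 {a b : S1 K} (ha : a ∈ S1.F K) (hb : b ∈ S1.F K) : a ⊗ₜ b ∈ F2 K := by
  let N : Submodule K (S2 K) := Submodule.span K {w | ∃ α β : ℕ × ℕ, w = E K α β}
  change a ⊗ₜ b ∈ N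
  refine (Submodule.span_le (p := N.comap ((TensorProduct.mk K (S1 K) (S1 K)).flip b))).2 ?_ ha
  rintro _ ⟨i, j, rfl⟩
  refine (Submodule.span_le (p := N.comap (TensorProduct.mk K (S1 K) (S1 K) (S1.E K i j)))).2 ?_ hb
  rintro _ ⟨k, l, rfl⟩
  exact Submodule.subset_span ⟨(i, k), (j, l), rfl⟩

theorem mul_mem_F2_left (w : S2 K) {f : S2 K} (hf : f ∈ F2 K) : w * f ∈ F2 K := by
  induction w using TensorProduct.induction_on with
  | zero => rw [zero_mul]; exact (F2 K).zero_mem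
  | add u v hu hv => rw [add_mul]; exact (F2 K).add_mem hu hv
  | tmul a b =>
    let N : Submodule K (S2 K) := Submodule.span K {w | ∃ α β : ℕ × ℕ, w = E K α β}
    refine (Submodule.span_le (p := N.comap (LinearMap.mulLeft K (a ⊗ₜ b : S2 K)))).2 ?_ hf
    rintro _ ⟨α, β, rfl⟩
    change (a ⊗ₜ b : S2 K) * (_ ⊗ₜ _) ∈ F2 K
    rw [Algebra.TensorProduct.tmul_mul_tmul]
    exact tmul_mem_F2 (S1.mul_mem_F_left _ _ (S1.E_mem_F _ _))
      (S1.mul_mem_F_left _ _ (S1.E_mem_F _ _))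

theorem mul_mem_F2_right (w : S2 K) {f : S2 K} (hf : f ∈ F2 K) : f * w ∈ F2 K := by
  induction w using TensorProduct.induction_on with
  | zero => rw [mul_zero]; exact (F2 K).zero_mem
  | add u v hu hv => rw [mul_add]; exact (F2 K).add_mem hu hv
  | tmul a b =>
    let N : Submodule K (S2 K) := Submodule.span K {w | ∃ α β : ℕ × ℕ, w = E K α β}
    refine (Submodule.span_le (p := N.comap (LinearMap.mulRight K (a ⊗ₜ b : S2 K)))).2 ?_ hf
    rintro _ ⟨α, β, rfl⟩
    change (_ ⊗ₜ _) * (a ⊗ₜ b : S2 K) ∈ F2 K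
    rw [Algebra.TensorProduct.tmul_mul_tmul]
    exact tmul_mem_F2 (S1.mul_mem_F_right _ _ (S1.E_mem_F _ _))
      (S1.mul_mem_F_right _ _ (S1.E_mem_F _ _))

/-! ### `GL_∞(𝕊₁)` inside the multiplicative monoid of `𝕊₂`. -/

variable (K) in
/-- The embedding of `GL_∞(𝕊₁) = (1 + 𝔭₁)^*` in the multiplicative monoid of `𝕊₂`. -/
noncomputable def toS2 : GLInf (S1 K) →* S2 K :=
  (onePlus (p1 K)).subtype.comp ((Units.coeHom _).comp (glEquiv K).toMonoidHom)

theorem toS2_injective : Function.Injective (toS2 K) := fun _ _ h =>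
  (glEquiv K).injective (Units.ext (Subtype.ext h))

theorem toS2_sub_one_mem (g : GLInf (S1 K)) : toS2 K g - 1 ∈ p1 K :=
  (glEquiv K g : onePlus (p1 K)).2

theorem toS2_toGL (u : (onePlus (F2 K))ˣ) :
    toS2 K (toGL K u) = ((u : onePlus (F2 K)) : S2 K) := by
  change ((glEquiv K ((glEquiv K).symm _) : onePlus (p1 K)) : S2 K) = _
  rw [MulEquiv.apply_symm_apply]
  rfl

theorem toGL_injective : Function.Injective (toGL K) := fun u v h =>
  Units.ext (Subtype.ext (by rw [← toS2_toGL, ← toS2_toGL, h]))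

theorem toS2_eq (g : GLInf (S1 K)) :
    toS2 K g = 1 + ofMat K (((g : onePlus (MInf (S1 K))) : ColMat (S1 K)) - 1) := rfl

/-! ### Elementary matrices. -/

/-- The matrix units with coefficients `a E_ij(1)`, `a ∈ 𝕊₁(2)`. -/
theorem unit_mul_unit (i j k l : ℕ) (a b : S1 K) :
    (S1.E K i j ⊗ₜ a : S2 K) * (S1.E K k l ⊗ₜ b) =
      if j = k then S1.E K i l ⊗ₜ (a * b) else 0 := by
  rw [Algebra.TensorProduct.tmul_mul_tmul, S1.E_mul_E]
  split_ifs
  · rfl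
  · rw [TensorProduct.zero_tmul]

theorem unit_mem_p1 (i j : ℕ) (a : S1 K) : (S1.E K i j ⊗ₜ a : S2 K) ∈ p1 K :=
  Submodule.subset_span ⟨i, j, a, rfl⟩

theorem exists_toS2_eq {v w : S2 K} (hv : v - 1 ∈ p1 K) (hw : w - 1 ∈ p1 K) (hvw : v * w = 1)
    (hwv : w * v = 1) : ∃ g : GLInf (S1 K), toS2 K g = v := by
  refine ⟨(glEquiv K).symm ⟨⟨v, hv⟩, ⟨w, hw⟩, Subtype.ext hvw, Subtype.ext hwv⟩, ?_⟩
  change ((glEquiv K ((glEquiv K).symm _) : onePlus (p1 K)) : S2 K) = _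
  rw [MulEquiv.apply_symm_apply]

/-- The elementary matrices belong to `E_∞(𝕊₁)`. -/
theorem exists_mem_EInf_elementary {i j : ℕ} (h : i ≠ j) (a : S1 K) :
    ∃ g ∈ EInf (S1 K), toS2 K g = 1 + S1.E K i j ⊗ₜ a := by
  have hz : ∀ b c : S1 K, (S1.E K i j ⊗ₜ b : S2 K) * (S1.E K i j ⊗ₜ c) = 0 := fun b c => by
    rw [unit_mul_unit, if_neg h.symm]
  obtain ⟨g, hg⟩ := exists_toS2_eq (v := 1 + S1.E K i j ⊗ₜ a) (w := 1 - S1.E K i j ⊗ₜ a)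
    (by rw [add_sub_cancel_left]; exact unit_mem_p1 i j a)
    (by rw [sub_sub_cancel_left]; exact (p1 K).neg_mem (unit_mem_p1 i j a))
    (by rw [add_mul, mul_sub, mul_sub, hz]; simp)
    (by rw [sub_mul, mul_add, mul_add, hz]; simp)
  refine ⟨g, Subgroup.subset_closure ⟨i, j, a, h, ?_⟩, hg⟩
  have h2 : ofMat K ((g : onePlus (MInf (S1 K))) - 1 : ColMat (S1 K)) =
      ofMat K (ColMat.unit i j a) := by
    rw [toS2_eq] at hg
    rw [add_left_cancel hg, ofMat_unit]
  have h3 : ((g : onePlus (MInf (S1 K))) - 1 : ColMat (S1 K)) = ColMat.unit i j a :=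
    ColMat.ext_entry fun k l => by
      rw [← slice_ofMat K (g : onePlus (MInf (S1 K))).2, h2, slice_ofMat K (unit_mem K i j a)]
  rw [← h3, add_sub_cancel]

/-- The elementary matrix with the diagonal block `(a, -(1 - a b); 0, b)` at the places `i, j`,
for `b a = 1`. -/
theorem exists_mem_EInf_block {i j : ℕ} (h : i ≠ j) {a b : S1 K} (hba : b * a = 1) :
    ∃ g ∈ EInf (S1 K), toS2 K g = 1 + S1.E K i i ⊗ₜ (a - 1) - S1.E K i j ⊗ₜ (1 - a * b) +
      S1.E K j j ⊗ₜ (b - 1) := by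
  -- Whitehead's factorization: `g₁ g₂ g₁` is the block `(1 - a b, a; -b, 0)`, where `b a = 1` has
  -- been used, and `g₃ g₄ g₃` is the block `(0, -1; 1, 0)`.
  obtain ⟨g₁, hg₁, e₁⟩ := exists_mem_EInf_elementary h a
  obtain ⟨g₂, hg₂, e₂⟩ := exists_mem_EInf_elementary h.symm (-b)
  obtain ⟨g₃, hg₃, e₃⟩ := exists_mem_EInf_elementary (K := K) h (-1)
  obtain ⟨g₄, hg₄, e₄⟩ := exists_mem_EInf_elementary (K := K) h.symm 1
  refine ⟨g₁ * g₂ * g₁ * (g₃ * g₄ * g₃), mul_mem (mul_mem (mul_mem hg₁ hg₂) hg₁)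
    (mul_mem (mul_mem hg₃ hg₄) hg₃), ?_⟩
  have hw : toS2 K (g₁ * g₂ * g₁) = 1 - S1.E K i i ⊗ₜ (a * b) + S1.E K i j ⊗ₜ a -
      S1.E K j i ⊗ₜ b - S1.E K j j ⊗ₜ 1 := by
    rw [map_mul, map_mul, e₁, e₂]
    simp only [mul_add, add_mul, mul_one, one_mul, unit_mul_unit, h.symm, if_true, if_false,
      mul_neg, neg_mul, mul_assoc, hba, TensorProduct.tmul_neg]
    abel
  have hv : toS2 K (g₃ * g₄ * g₃) = 1 - S1.E K i i ⊗ₜ 1 - S1.E K i j ⊗ₜ 1 +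
      S1.E K j i ⊗ₜ 1 - S1.E K j j ⊗ₜ 1 := by
    rw [map_mul, map_mul, e₃, e₄]
    simp only [mul_add, add_mul, mul_one, one_mul, unit_mul_unit, h.symm, if_true, if_false,
      mul_neg, neg_mul, TensorProduct.tmul_neg]
    abel
  rw [map_mul, hw, hv]
  simp only [mul_add, add_mul, mul_sub, sub_mul, mul_one, one_mul, unit_mul_unit, h, h.symm,
    if_true, if_false, TensorProduct.tmul_sub]
  abel

/-- If `b a = 1` and `c` is a nonzero scalar, then the diagonal matrix with the entry
`1 + (c - 1)(1 - a b)` at place `i` is elementary. -/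
theorem exists_mem_EInf_diag (i : ℕ) {a b : S1 K} (hba : b * a = 1) {c : K} (hc : c ≠ 0) :
    ∃ g ∈ EInf (S1 K), toS2 K g = 1 + (c - 1) • (S1.E K i i ⊗ₜ (1 - a * b)) := by
  -- The block `g` sits at places `i, i + 1`, and `f` is the scalar diagonal matrix with `c⁻¹` at
  -- `i` and `c` at `i + 2`. The compensating `c` thus avoids `g`, and the commutator sees only the
  -- corner `1 - a b`.
  have hij : i ≠ i + 1 := by omega
  have hik : i ≠ i + 2 := by omega
  have hjk : i + 1 ≠ i + 2 := by omega
  obtain ⟨g, hg, e⟩ := exists_mem_EInf_block hij hba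
  obtain ⟨f, hf, e'⟩ := exists_mem_EInf_block (K := K) hik
    (a := algebraMap K _ c⁻¹) (b := algebraMap K _ c)
    (by rw [← map_mul, mul_inv_cancel₀ hc, map_one])
  refine ⟨g * f * (f * g)⁻¹, mul_mem (mul_mem hg hf) (inv_mem (mul_mem hf hg)), ?_⟩
  have hf' : toS2 K f = 1 + (c⁻¹ - 1) • (S1.E K i i ⊗ₜ 1) +
      (c - 1) • (S1.E K (i + 2) (i + 2) ⊗ₜ 1) := by
    rw [e', ← map_mul, inv_mul_cancel₀ hc, map_one, sub_self, TensorProduct.tmul_zero, sub_zero]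
    simp only [Algebra.algebraMap_eq_smul_one, TensorProduct.tmul_sub, TensorProduct.tmul_smul,
      sub_smul, one_smul]
  -- The claimed factor fixes `a`, because `(1 - a b) a = 0`, and multiplies the corner by `c`,
  -- because `1 - a b` is idempotent. This is exactly the difference between `g f` and `f g`.
  have key : toS2 K (g * f) =
      (1 + (c - 1) • (S1.E K i i ⊗ₜ (1 - a * b))) * toS2 K (f * g) := by
    have hbab : b * (a * b) = b := by rw [← mul_assoc, hba, one_mul]
    rw [map_mul, map_mul, hf', e]
    simp only [mul_add, add_mul, mul_sub, sub_mul, mul_one, one_mul, unit_mul_unit, hij, hij.symm,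
      hik, hik.symm, hjk, hjk.symm, if_true, if_false, TensorProduct.tmul_sub, smul_mul_assoc,
      mul_smul_comm, mul_zero, mul_assoc, hba, hbab, smul_zero, smul_add, smul_sub, smul_smul,
      inv_mul_cancel₀ hc]
    module
  rw [map_mul, key, mul_assoc, ← map_mul, mul_inv_cancel, map_one, mul_one]

theorem exists_mem_EInf_x_pow (i n : ℕ) {c : K} (hc : c ≠ 0) :
    ∃ g ∈ EInf (S1 K), toS2 K g =
      1 + (c - 1) • (S1.E K i i ⊗ₜ (1 - S1.x K ^ n * S1.y K ^ n)) :=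
  exists_mem_EInf_diag i (S1.y_pow_mul_x_pow K n) hc

/-- The idempotents `1 - x^n y^n` for `n = α.2` and `n = α.2 + 1` differ by `E_nn`, so the quotient
of the two corresponding elements is concentrated at `α`. -/
theorem exists_mem_EInf_diagonal (α : ℕ × ℕ) {c : K} (hc : c ≠ 0) :
    ∃ g ∈ EInf (S1 K), toS2 K g = 1 + (c - 1) • E K α α := by
  obtain ⟨g, hg, e⟩ := exists_mem_EInf_x_pow α.1 α.2 hc
  obtain ⟨f, hf, e'⟩ := exists_mem_EInf_x_pow α.1 (α.2 + 1) hc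
  refine ⟨g⁻¹ * f, mul_mem (inv_mem hg) hf, ?_⟩
  have key : toS2 K f = toS2 K g * (1 + (c - 1) • E K α α) := by
    have hz : (S1.E K α.1 α.1 ⊗ₜ (1 - S1.x K ^ α.2 * S1.y K ^ α.2) : S2 K) * E K α α = 0 := by
      rw [E, Algebra.TensorProduct.tmul_mul_tmul, S1.one_sub_x_pow_mul_y_pow_mul_E,
        TensorProduct.tmul_zero]
    rw [e, e', S1.one_sub_x_pow_mul_y_pow_succ, TensorProduct.tmul_add, add_mul, one_mul, mul_add,
      mul_one, smul_mul_smul_comm, hz, smul_zero, add_zero, smul_add, E]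
    abel
  rw [map_mul, key, ← mul_assoc, ← map_mul, inv_mul_cancel, map_one, one_mul]

/-- If the first coordinates differ, this is already an elementary matrix over `𝕊₁`. Otherwise an
auxiliary row is introduced and the transvection is a commutator `[1 + A, 1 + B]` with `A B = c
E_αβ`; here `B A = 0` because `α.2 ≠ β.2`. -/
theorem exists_mem_EInf_transvection {α β : ℕ × ℕ} (h : α ≠ β) (c : K) :
    ∃ g ∈ EInf (S1 K), toS2 K g = 1 + c • E K α β := by
  by_cases h1 : α.1 = β.1
  · have h2 : α.2 ≠ β.2 := fun h2 => h (Prod.ext h1 h2)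
    have hk : α.1 ≠ α.1 + 1 := by omega
    obtain ⟨g, hg, e⟩ := exists_mem_EInf_elementary hk (c • S1.E K α.2 0)
    obtain ⟨f, hf, e'⟩ := exists_mem_EInf_elementary hk.symm (S1.E K 0 β.2)
    refine ⟨g * f * (f * g)⁻¹, mul_mem (mul_mem hg hf) (inv_mem (mul_mem hf hg)), ?_⟩
    have key : toS2 K (g * f) = (1 + c • E K α β) * toS2 K (f * g) := by
      rw [map_mul, map_mul, e, e', E, ← h1]
      simp only [mul_add, add_mul, mul_one, one_mul, unit_mul_unit, hk, if_true,
        if_false, smul_mul_assoc, mul_smul_comm, mul_zero, S1.E_mul_E, h2.symm,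
        TensorProduct.tmul_smul, TensorProduct.tmul_zero, smul_zero]
      abel
    rw [map_mul, key, mul_assoc, ← map_mul, mul_inv_cancel, map_one, mul_one]
  · obtain ⟨g, hg, e⟩ := exists_mem_EInf_elementary h1 (c • S1.E K α.2 β.2)
    exact ⟨g, hg, by rw [e, E, TensorProduct.tmul_smul]⟩

/-! ### Gaussian elimination in `(1 + F₂)^*`. -/

theorem ofBlock_zero (s : Finset (ℕ × ℕ)) : ofBlock K s 0 = 0 := by
  simp [ofBlock]

theorem ofBlock_add (s : Finset (ℕ × ℕ)) (A B : Matrix s s K) :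
    ofBlock K s (A + B) = ofBlock K s A + ofBlock K s B := by
  simp [ofBlock, add_smul, Finset.sum_add_distrib]

theorem ofBlock_single (s : Finset (ℕ × ℕ)) (a b : s) (c : K) :
    ofBlock K s (Matrix.single a b c) = c • E K a b := by
  rw [ofBlock, Finset.sum_eq_single a, Finset.sum_eq_single b]
  · simp
  · intro d _ hd
    simp [hd.symm]
  · simp
  · intro d _ hd
    exact Finset.sum_eq_zero fun _ _ => by simp [hd.symm]
  · simp

/-- The homomorphism of monoids `M_s(K) → 1 + F₂`, `A ↦ 1 + (A - 1)`. -/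
noncomputable def oneAddBlock (s : Finset (ℕ × ℕ)) : Matrix s s K →* S2 K where
  toFun A := 1 + ofBlock K s (A - 1)
  map_one' := by rw [sub_self, ofBlock_zero, add_zero]
  map_mul' A B := by
    have h : A * B - 1 = (A - 1) + (B - 1) + (A - 1) * (B - 1) := by
      rw [sub_mul, mul_sub, mul_one, one_mul]
      abel
    rw [h, ofBlock_add, ofBlock_add, ofBlock_mul, add_mul, one_mul, mul_add, mul_one]
    abel

theorem oneAddBlock_apply (s : Finset (ℕ × ℕ)) (A : Matrix s s K) :
    oneAddBlock s A = 1 + ofBlock K s (A - 1) := rfl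

theorem exists_mem_EInf_mul {v w : S2 K} (hv : ∃ g ∈ EInf (S1 K), toS2 K g = v)
    (hw : ∃ g ∈ EInf (S1 K), toS2 K g = w) : ∃ g ∈ EInf (S1 K), toS2 K g = v * w := by
  obtain ⟨g, hg, rfl⟩ := hv
  obtain ⟨f, hf, rfl⟩ := hw
  exact ⟨g * f, mul_mem hg hf, map_mul _ _ _⟩

theorem exists_mem_EInf_oneAddBlock (s : Finset (ℕ × ℕ)) (A : Matrix s s K) (hA : A.det ≠ 0) :
    ∃ g ∈ EInf (S1 K), toS2 K g = oneAddBlock s A := by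
  refine Matrix.diagonal_transvection_induction_of_det_ne_zero
    (fun A => ∃ g ∈ EInf (S1 K), toS2 K g = oneAddBlock s A) A hA ?_ ?_ ?_
  · intro D hD
    have hD' : ∀ a, D a ≠ 0 := by
      rw [Matrix.det_diagonal, Finset.prod_ne_zero_iff] at hD
      exact fun a => hD a (Finset.mem_univ a)
    -- The diagonal matrix is built one entry at a time.
    have key : ∀ t : Finset s, ∃ g ∈ EInf (S1 K), toS2 K g =
        oneAddBlock s (Matrix.diagonal fun a => if a ∈ t then D a else 1) := by
      intro t
      induction t using Finset.induction_on with
      | empty => exact ⟨1, one_mem _, by simp⟩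
      | insert b t hb ih =>
        have h : (Matrix.diagonal fun a => if a ∈ insert b t then D a else 1) =
            (1 + Matrix.single b b (D b - 1)) *
              Matrix.diagonal fun a => if a ∈ t then D a else 1 := by
          have h1 : (1 + Matrix.single b b (D b - 1) : Matrix s s K) =
              Matrix.diagonal fun a => if a = b then D b else 1 := by
            ext a c
            simp only [Matrix.add_apply, Matrix.one_apply, Matrix.single_apply,
              Matrix.diagonal_apply]
            by_cases h2 : a = b <;> by_cases h3 : c = b <;>
              simp [h2, h3, eq_comm (a := b)]
          rw [h1, Matrix.diagonal_mul_diagonal]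
          congr 1
          funext a
          by_cases h2 : a = b
          · subst h2
            simp [hb]
          · simp [h2]
        rw [h, map_mul]
        refine exists_mem_EInf_mul ?_ ih
        rw [oneAddBlock_apply, add_sub_cancel_left, ofBlock_single]
        exact exists_mem_EInf_diagonal _ (hD' b)
    simpa using key Finset.univ
  · intro t
    rw [Matrix.TransvectionStruct.toMatrix, Matrix.transvection, oneAddBlock_apply,
      add_sub_cancel_left, ofBlock_single]
    exact exists_mem_EInf_transvection (fun h => t.hij (Subtype.ext h)) _
  · intro A B _ _ hA hB
    rw [map_mul]
    exact exists_mem_EInf_mul hA hB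

theorem block_one (s : Finset (ℕ × ℕ)) : block K s (1 : S2 K) = 1 := by
  ext a b
  simp only [block, Matrix.of_apply, coef_one, Matrix.one_apply, Subtype.ext_iff]

theorem block_add (s : Finset (ℕ × ℕ)) (v w : S2 K) :
    block K s (v + w) = block K s v + block K s w := by
  ext a b
  simp [block]

theorem toGL_mem_EInf (u : (onePlus (F2 K))ˣ) : toGL K u ∈ EInf (S1 K) := by
  classical
  obtain ⟨s, hs⟩ := exists_ofBlock K (u : onePlus (F2 K)).2
  have h := hs _ (Finset.subset_union_left (s₂ := (idx_finite K (u : onePlus (F2 K)).2).toFinset))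
  have hd := detFun_eq K (u : onePlus (F2 K)) _ (Finset.subset_union_right (s₁ := s))
  -- The index set must be large enough both to recover `u - 1` from its block and to compute the
  -- determinant of `u`.
  set t := s ∪ (idx_finite K (u : onePlus (F2 K)).2).toFinset
  have h0 : (block K t ((u : onePlus (F2 K)) : S2 K)).det ≠ 0 := by
    rw [← hd]
    exact (det K u).ne_zero
  obtain ⟨g, hg, e⟩ := exists_mem_EInf_oneAddBlock t _ h0
  have h1 : block K t ((u : onePlus (F2 K)) : S2 K) =
      block K t (((u : onePlus (F2 K)) : S2 K) - 1) + 1 := by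
    rw [← block_one, ← block_add, sub_add_cancel]
  have h2 : g = toGL K u := toS2_injective (by
    rw [e, toS2_toGL, oneAddBlock_apply, h1, add_sub_cancel_right, ← h, add_sub_cancel])
  rwa [← h2]

/-! ### Conjugation invariance of the determinant. -/

theorem detMon_one_add_mul_comm {f g : S2 K} (hf : f ∈ F2 K) (hg : g ∈ F2 K)
    {u v : onePlus (F2 K)} (hu : (u : S2 K) = 1 + f * g) (hv : (v : S2 K) = 1 + g * f) :
    detMon K u = detMon K v := by
  classical
  obtain ⟨s, hs⟩ := exists_ofBlock K hf
  obtain ⟨s', hs'⟩ := exists_ofBlock K hg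
  let t := s ∪ s' ∪ ((idx_finite K u.2).toFinset ∪ (idx_finite K v.2).toFinset)
  have hf' := hs t (by intro a ha; simp only [t, Finset.mem_union]; tauto)
  have hg' := hs' t (by intro a ha; simp only [t, Finset.mem_union]; tauto)
  change detFun K u = detFun K v
  rw [detFun_eq K u t (by intro a ha; simp only [t, Finset.mem_union]; tauto),
    detFun_eq K v t (by intro a ha; simp only [t, Finset.mem_union]; tauto), hu, hv, hf', hg',
    ← ofBlock_mul, ← ofBlock_mul, block_add, block_add, block_one, block_ofBlock, block_ofBlock,
    Matrix.det_one_add_mul_comm]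

/-- The identity of a large enough finite block is a local unit for `f`. -/
theorem exists_mul_eq_self {f : S2 K} (hf : f ∈ F2 K) : ∃ p ∈ F2 K, p * f = f ∧ f * p = f := by
  obtain ⟨s, hs⟩ := exists_ofBlock K hf
  have h := hs s subset_rfl
  refine ⟨ofBlock K s 1, ?_, ?_, ?_⟩
  · exact sum_mem fun a _ => sum_mem fun b _ =>
      Submodule.smul_mem _ _ (Submodule.subset_span ⟨_, _, rfl⟩)
  · rw [h, ← ofBlock_mul, one_mul]
  · rw [h, ← ofBlock_mul, mul_one]

/-- `(1 + F₂)^*` is the set of those `g ∈ GL_∞(𝕊₁)` with `g - 1 ∈ F₂`. -/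
theorem exists_toGL_eq {g : GLInf (S1 K)} (hg : toS2 K g - 1 ∈ F2 K) : ∃ u, toGL K u = g := by
  -- The inverse stays in `1 + F₂` because `F₂` is an ideal and `g⁻¹ - 1 = -g⁻¹ (g - 1)`.
  have hg' : toS2 K g⁻¹ - 1 ∈ F2 K := by
    have h : toS2 K g⁻¹ - 1 = -(toS2 K g⁻¹ * (toS2 K g - 1)) := by
      rw [mul_sub, ← map_mul, inv_mul_cancel, map_one, mul_one, neg_sub]
    rw [h]
    exact (F2 K).neg_mem (mul_mem_F2_left _ hg)
  refine ⟨⟨⟨_, hg⟩, ⟨_, hg'⟩, Subtype.ext ?_, Subtype.ext ?_⟩, toS2_injective ?_⟩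
  · change toS2 K g * toS2 K g⁻¹ = 1
    rw [← map_mul, mul_inv_cancel, map_one]
  · change toS2 K g⁻¹ * toS2 K g = 1
    rw [← map_mul, inv_mul_cancel, map_one]
  · rw [toS2_toGL]

/-- The determinant is invariant under conjugation by elements of `GL_∞(𝕊₁)`. -/
theorem exists_conj_toGL (g : GLInf (S1 K)) (u : (onePlus (F2 K))ˣ) :
    ∃ v, toGL K v = g * toGL K u * g⁻¹ ∧ det K v = det K u := by
  have hu : ((u : onePlus (F2 K)) : S2 K) - 1 ∈ F2 K := (u : onePlus (F2 K)).2
  have hu1 : ((u : onePlus (F2 K)) : S2 K) = 1 + (((u : onePlus (F2 K)) : S2 K) - 1) := by abel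
  set f := ((u : onePlus (F2 K)) : S2 K) - 1
  obtain ⟨p, hp, hpf, hfp⟩ := exists_mul_eq_self hu
  have hgg : toS2 K g * toS2 K g⁻¹ = 1 := by rw [← map_mul, mul_inv_cancel, map_one]
  have hgg' : toS2 K g⁻¹ * toS2 K g = 1 := by rw [← map_mul, inv_mul_cancel, map_one]
  -- Inserting the local unit `p` puts both factors in `F₂`, although `g` and `g⁻¹` need not have
  -- finite matrices. In the opposite order the product collapses to `p f = f`.
  have h : toS2 K (g * toGL K u * g⁻¹) = 1 + (toS2 K g * f) * (p * toS2 K g⁻¹) := by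
    rw [map_mul, map_mul, toS2_toGL, hu1, mul_add, add_mul, mul_one, hgg, ← mul_assoc,
      mul_assoc _ f p, hfp]
  have hF := mul_mem_F2_left (toS2 K g) hu
  have hF' := mul_mem_F2_right (toS2 K g⁻¹) hp
  obtain ⟨v, hv⟩ := exists_toGL_eq (g := g * toGL K u * g⁻¹)
    (by rw [h, add_sub_cancel_left]; exact (F2 K).mul_mem hF hF')
  refine ⟨v, hv, Units.ext ?_⟩
  refine detMon_one_add_mul_comm hF hF' (by rw [← toS2_toGL, hv, h]) ?_
  rw [mul_assoc, ← mul_assoc _ _ f, hgg', one_mul, hpf, hu1]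

theorem SLsub_normal : (SLsub K).Normal := by
  refine ⟨?_⟩
  rintro _ ⟨u, hu, rfl⟩ g
  obtain ⟨v, hv, hd⟩ := exists_conj_toGL g u
  exact ⟨v, hd.trans hu, hv⟩

theorem det_mu' (c : Kˣ) : det K (mu' K c) = c := by
  classical
  refine Units.ext ?_
  change detFun K (mu' K c : onePlus (F2 K)) = c
  -- The index `(0, 0)` is added by hand, since the support is empty when `c = 1`.
  let t := {(0, 0)} ∪ (idx_finite K (mu' K c : onePlus (F2 K)).2).toFinset
  have h0 : ((0, 0) : ℕ × ℕ) ∈ t := by simp [t]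
  rw [detFun_eq K _ t Finset.subset_union_right]
  have h : block K t ((mu' K c : onePlus (F2 K)) : S2 K) =
      Matrix.diagonal fun a => if a = ⟨(0, 0), h0⟩ then (c : K) else 1 := by
    ext a b
    change coef K a b ((c : K) • E K (0, 0) (0, 0) + 1 - E K (0, 0) (0, 0)) = _
    simp only [map_sub, map_add, map_smul, coef_E, coef_one, Matrix.diagonal_apply, Subtype.ext_iff,
      smul_eq_mul]
    by_cases ha : (0, 0) = (a : ℕ × ℕ) <;> by_cases hb : (0, 0) = (b : ℕ × ℕ)
    · simp [← ha, ← hb]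
    · simp [← ha, hb]
    · simp [ha, ← hb, Ne.symm ha]
    · simp [ha, hb, Ne.symm ha]
  rw [h, Matrix.det_diagonal, Finset.prod_ite_eq' ]
  simp

theorem toGL_mem_SLsub {u : (onePlus (F2 K))ˣ} : toGL K u ∈ SLsub K ↔ det K u = 1 := by
  refine ⟨?_, fun h => ⟨u, h, rfl⟩⟩
  rintro ⟨v, hv, h⟩
  rw [← toGL_injective h]
  exact hv

/-! ### The centres modulo `SL`. -/

/-- `f ∈ 𝔭₁` vanishes outside finitely many rows and columns. -/
theorem exists_support_p1 {f : S2 K} (hf : f ∈ p1 K) :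
    ∃ d, ∀ e, d ≤ e → (∀ i, (S1.E K i e ⊗ₜ 1 : S2 K) * f = 0) ∧
      f = ∑ i ∈ Finset.range e, f * (S1.E K i e ⊗ₜ 1) * (S1.E K e i ⊗ₜ 1) := by
  obtain ⟨m, ⟨d, hd⟩, rfl⟩ := exists_ofMat K hf
  refine ⟨d, fun e he => ⟨fun i => ?_, ?_⟩⟩
  · rw [ofMat_eq K _ hd, Finset.mul_sum]
    refine Finset.sum_eq_zero fun k hk => ?_
    rw [Finset.mem_range] at hk
    rw [Finset.mul_sum]
    exact Finset.sum_eq_zero fun l _ => by rw [unit_mul_unit, if_neg (by omega)]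
  -- Since `E_ie E_ei = E_ii`, the claim is that `E_00(1) + ⋯ + E_(e-1)(e-1)(1)` is a right unit for
  -- `f`.
  · simp only [mul_assoc, unit_mul_unit, if_true, mul_one]
    rw [ofMat_eq K _ (hd.mono he)]
    simp only [Finset.sum_mul, unit_mul_unit]
    conv_rhs => rw [Finset.sum_comm]
    refine Finset.sum_congr rfl fun k _ => ?_
    conv_rhs => rw [Finset.sum_comm]
    refine Finset.sum_congr rfl fun l hl => ?_
    rw [Finset.sum_eq_single l]
    · simp
    · intro b _ hb
      rw [if_neg hb.symm]
    · intro h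
      exact absurd hl h

/-- An element of `GL_∞(𝕊₁)` which commutes with `E_∞(𝕊₁)` modulo `SL` belongs to `U' SL`. -/
theorem exists_mu'_of_commute {g : GLInf (S1 K)}
    (hg : ∀ h ∈ EInf (S1 K), (h * g)⁻¹ * (g * h) ∈ SLsub K) :
    ∃ c : Kˣ, (toGL K (mu' K c))⁻¹ * g ∈ SLsub K := by
  have hcomm : ∀ h ∈ EInf (S1 K), toS2 K g * toS2 K h - toS2 K h * toS2 K g ∈ F2 K := by
    intro h hh
    obtain ⟨u, -, hu⟩ := hg h hh
    have h1 : toS2 K g * toS2 K h - toS2 K h * toS2 K g =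
        toS2 K h * toS2 K g * (((u : onePlus (F2 K)) : S2 K) - 1) := by
      rw [← toS2_toGL, hu, mul_sub, mul_one, ← map_mul, ← map_mul, ← map_mul, mul_inv_cancel_left]
    rw [h1]
    exact mul_mem_F2_left _ (u : onePlus (F2 K)).2
  obtain ⟨d, hd⟩ := exists_support_p1 (toS2_sub_one_mem g)
  obtain ⟨hz, hs⟩ := hd d le_rfl
  have hF : toS2 K g - 1 ∈ F2 K := by
    rw [hs]
    refine sum_mem fun i hi => mul_mem_F2_right _ ?_
    -- For `h = 1 + E_id(1)`, the additive commutator of `g` and `h` is `(g - 1) E_id(1)`, as row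
    -- `d` of `g - 1` is zero. Each summand of `g - 1` is thereby put in `F₂`.
    obtain ⟨h, hh, e⟩ := exists_mem_EInf_elementary (K := K) (Finset.mem_range.1 hi).ne 1
    have h1 := hcomm h hh
    have h2 : toS2 K g * toS2 K h - toS2 K h * toS2 K g =
        (toS2 K g - 1) * (S1.E K i d ⊗ₜ 1) - (S1.E K i d ⊗ₜ 1) * (toS2 K g - 1) := by
      rw [e, mul_add, add_mul, sub_mul, mul_sub, mul_one, mul_one, one_mul, one_mul]
      abel
    rwa [h2, hz, sub_zero] at h1
  obtain ⟨u, rfl⟩ := exists_toGL_eq hF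
  refine ⟨det K u, ?_⟩
  rw [← map_inv, ← map_mul, toGL_mem_SLsub, map_mul, map_inv, det_mu', inv_mul_cancel]

/-- With `v = g u g⁻¹`, the commutator is a conjugate of `u⁻¹ v`, whose determinant is `1`. -/
theorem toGL_commute_mod_SLsub (u : (onePlus (F2 K))ˣ) (g : GLInf (S1 K)) :
    (toGL K u * g)⁻¹ * (g * toGL K u) ∈ SLsub K := by
  obtain ⟨v, hv, hd⟩ := exists_conj_toGL g u
  have h : (toGL K u * g)⁻¹ * (g * toGL K u) = g⁻¹ * toGL K (u⁻¹ * v) * g⁻¹⁻¹ := by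
    rw [map_mul, map_inv, hv]
    group
  rw [h]
  refine SLsub_normal.conj_mem _ ?_ _
  rw [toGL_mem_SLsub, map_mul, map_inv, hd, inv_mul_cancel]

end S2

theorem mainTheorem5 (K : Type*) [Field K] :
    SLsub K ≤ EInf (S1 K) ∧ U' K ≤ EInf (S1 K) ∧
    ∃ _ : (SLsub K).Normal,
      Function.Injective
        ((QuotientGroup.mk' (SLsub K)).comp ((S2.toGL K).comp (S2.mu' K))) ∧
      Subgroup.center (GLInf (S1 K) ⧸ SLsub K) =
        (U' K).map (QuotientGroup.mk' (SLsub K)) ∧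
      Subgroup.center (EInf (S1 K) ⧸ (SLsub K).subgroupOf (EInf (S1 K))) =
        ((U' K).subgroupOf (EInf (S1 K))).map
          (QuotientGroup.mk' ((SLsub K).subgroupOf (EInf (S1 K)))) := by
  have hU : U' K ≤ EInf (S1 K) := by
    rintro _ ⟨u, -, rfl⟩
    exact S2.toGL_mem_EInf u
  have hN : (SLsub K).Normal := S2.SLsub_normal
  refine ⟨?_, hU, hN, ?_, ?_, ?_⟩
  · rintro _ ⟨u, -, rfl⟩
    exact S2.toGL_mem_EInf u
  · rw [injective_iff_map_eq_one]
    intro c hc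
    have h : S2.toGL K (S2.mu' K c) ∈ SLsub K := (QuotientGroup.eq_one_iff _).1 hc
    rwa [S2.toGL_mem_SLsub, S2.det_mu'] at h
  · ext q
    rw [Subgroup.mem_center_iff]
    constructor
    · induction q using QuotientGroup.induction_on with | H g
      intro hq
      -- Commutation with all of `GL_∞(𝕊₁)` is used only for elementary `h`, exactly as for the
      -- second centre.
      obtain ⟨c, hc⟩ := S2.exists_mu'_of_commute (g := g) fun h _ =>
        QuotientGroup.eq.1 (hq h)
      exact ⟨_, ⟨_, ⟨c, rfl⟩, rfl⟩, QuotientGroup.eq.2 hc⟩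
    · rintro ⟨_, ⟨u, -, rfl⟩, rfl⟩ r
      induction r using QuotientGroup.induction_on with | H g
      exact (QuotientGroup.eq.2 (S2.toGL_commute_mod_SLsub u g)).symm
  · ext q
    rw [Subgroup.mem_center_iff]
    constructor
    · induction q using QuotientGroup.induction_on with | H g
      intro hq
      have hq' : ∀ h : EInf (S1 K), (h * g)⁻¹ * (g * h) ∈ (SLsub K).subgroupOf (EInf (S1 K)) :=
        fun h => QuotientGroup.eq.1 (by exact hq h)
      obtain ⟨c, hc⟩ := S2.exists_mu'_of_commute (g := (g : GLInf (S1 K))) fun h hh =>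
        Subgroup.mem_subgroupOf.1 (hq' ⟨h, hh⟩)
      have hc' : S2.toGL K (S2.mu' K c) ∈ U' K := ⟨_, ⟨c, rfl⟩, rfl⟩
      exact ⟨⟨_, hU hc'⟩, hc', QuotientGroup.eq.2 hc⟩
    · rintro ⟨v, ⟨u, -, hu⟩, rfl⟩ r
      induction r using QuotientGroup.induction_on with | H g
      refine (QuotientGroup.eq (a := v * g) (b := g * v).2 (Subgroup.mem_subgroupOf.2 ?_)).symm
      have h := S2.toGL_commute_mod_SLsub u (g : GLInf (S1 K))
      rw [hu] at h
      exact h
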